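/- Let $I$ be a lower semilattice (possibly empty), and let $\mathbb{M}=((M_i)_{i\in I},(p_{ij}\colon M_j\to M_i)_{i\leq j})$ be a projective system of commutative monoids over $I$ that is openly immersive, i.e. $\operatorname{Spec}\mathbb{Z}[p_{ij}]\colon\operatorname{Spec}\mathbb{Z}[M_i]\to\operatorname{Spec}\mathbb{Z}[M_j]$ is an open immersion whenever $i\leq j$. Suppose that the inductive system $(\operatorname{Spec}\mathbb{Z}[M_i])_{i\in I}$ can be glued, i.e. that there are a scheme $Y$ and open immersions $\operatorname{Spec}\mathbb{Z}[M_i]\to Y$ $(i\in I)$ compatible with the transition morphisms. Then it has an inductive limit $X_{\mathbb{M}}(\mathbb{Z})$ in the category of schemes, and the canonical morphisms $\operatorname{Spec}\mathbb{Z}[M_i]\to X_{\mathbb{M}}(\mathbb{Z})$ are open immersions. For a scheme $S$ put $X_{\mathbb{M}}(S):=X_{\mathbb{M}}(\mathbb{Z})\times S$. We say that $\mathbb{M}$ is of finite type if every monoid $M_i$ is finitely generated; that a scheme is topologically (locally) noetherian if its underlying topological space is (locally) noetherian; that it is pointwise noetherian if all stalks of its structure sheaf are noetherian rings; and that it is jacobsonian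 if its underlying topological space is a Jacobson space (the closed points are dense in every closed subset). Let $S$ be a scheme. a) $X_{\mathbb{M}}(S)$ is locally noetherian if and only if $I=\emptyset$, or $S$ is locally noetherian and ($\mathbb{M}$ is of finite type or $S=\emptyset$). b) If $X_{\mathbb{M}}(S)$ is noetherian, then $I=\emptyset$, or $S$ is noetherian and ($\mathbb{M}$ is of finite type or $S=\emptyset$); if $I$ is finite, then the converse holds. c) If $X_{\mathbb{M}}(S)$ is pointwise noetherian, then $S$ is pointwise noetherian or $I=\emptyset$; if $\mathbb{M}$ is of finite type, then the converse holds. d) Consider the statements (1) $X_{\mathbb{M}}(S)$ is topologically locally noetherian; (2) $S$ is topologically locally noetherian or $I=\emptyset$. If $I$ is finite, then (1) implies (2); if $\mathbb{M}$ is of finite type, then (2) implies (1). e) If $X_{\mathbb{M}}(S)$ is topologically noetherian, then $S$ is topologically noetherian or $I=\emptyset$; if $I$ is finite and $\mathbb{M}$ is of finite type, then the converse holds. f) If $X_{\mathbb{M}}(S)$ is jacobsonian, then $S$ is jacobsonian or $I=\emptyset$; if $\mathbb{M}$ is of finite type, then the converse holds. -/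

import Mathlib

universe u

namespace MonoidGluing

open CategoryTheory CategoryTheory.Limits AlgebraicGeometry Opposite TopologicalSpace Topology

noncomputable section

/-- The functor `M ↦ ℤ[M]` from commutative (additively written) monoids to commutative rings. -/
def monoidRing : AddCommMonCat.{u} ⥤ CommRingCat.{u} where
  obj M := CommRingCat.of (AddMonoidAlgebra ℤ M)
  map f := CommRingCat.ofHom (AddMonoidAlgebra.mapDomainRingHom ℤ f.hom)
  map_id M := by
    ext1
    exact AddMonoidAlgebra.mapDomainRingHom_id
  map_comp f g := by
    ext1
    exact AddMonoidAlgebra.mapDomainRingHom_comp g.hom f.hom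

section System

variable {I : Type u} [SemilatticeInf I]

/-- A projective system of monoids `((M_i)_{i ∈ I}, (p_{ij} : M_j → M_i)_{i ≤ j})` over `I` is a
functor `Iᵒᵖ ⥤ AddCommMonCat`. This is the associated inductive system of affine schemes
`i ↦ Spec ℤ[M_i]` with the morphisms `Spec ℤ[p_{ij}] : Spec ℤ[M_i] ⟶ Spec ℤ[M_j]` for `i ≤ j`. -/
def charts (M : Iᵒᵖ ⥤ AddCommMonCat.{u}) : I ⥤ Scheme.{u} :=
  (M ⋙ monoidRing).rightOp ⋙ Scheme.Spec

/-- `M` is openly immersive if `Spec ℤ[p_{ij}]` is an open immersion for all `i ≤ j`. -/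
def OpenlyImmersive (M : Iᵒᵖ ⥤ AddCommMonCat.{u}) : Prop :=
  ∀ ⦃i j : I⦄ (h : i ≤ j), IsOpenImmersion ((charts M).map (homOfLE h))

/-- `M` is of finite type if every `M_i` is a finitely generated monoid. -/
def FiniteType (M : Iᵒᵖ ⥤ AddCommMonCat.{u}) : Prop :=
  ∀ i : I, AddMonoid.FG (M.obj (op i))

end System

section Gluing

variable {I : Type u} [Category.{u} I]

/-- A diagram of schemes is gluable if its members can be simultaneously embedded as open
subschemes of some scheme, compatibly with the transition morphisms. -/
class IsGluable (F : I ⥤ Scheme.{u}) : Prop where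
  exists_cocone : ∃ c : Cocone F, ∀ i, IsOpenImmersion (c.ι.app i)

/-- Auxiliary: pairs of an index `i` and an open subset of `F i`. -/
structure Piece (F : I ⥤ Scheme.{u}) where
  idx : I
  opn : (F.obj idx).Opens

variable {F : I ⥤ Scheme.{u}}

/-- Auxiliary: the morphism from a piece to the tip of a cocone. -/
def Piece.leg (A : Piece F) (s : Cocone F) : (A.opn : Scheme.{u}) ⟶ s.pt :=
  A.opn.ι ≫ s.ι.app A.idx

/-- Auxiliary: morphisms of pieces are those compatible with all cocones. -/
@[ext]
structure Piece.Hom (A B : Piece F) where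
  mor : (A.opn : Scheme.{u}) ⟶ (B.opn : Scheme.{u})
  w : ∀ s : Cocone F, mor ≫ B.leg s = A.leg s

instance : Category.{u} (Piece F) where
  Hom A B := Piece.Hom A B
  id A := ⟨𝟙 _, fun s => Category.id_comp _⟩
  comp f g := ⟨f.mor ≫ g.mor, fun s => by rw [Category.assoc, g.w, f.w]⟩
  id_comp f := Piece.Hom.ext (Category.id_comp _)
  comp_id f := Piece.Hom.ext (Category.comp_id _)
  assoc f g h := Piece.Hom.ext (Category.assoc _ _ _)

/-- Auxiliary: the diagram of all pieces. -/
def pieces (F : I ⥤ Scheme.{u}) : Piece F ⥤ Scheme.{u} where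
  obj A := A.opn
  map f := Piece.Hom.mor f
  map_id _ := rfl
  map_comp _ _ := rfl

theorem isOpenImmersion_leg (c : Cocone F) (hc : ∀ i, IsOpenImmersion (c.ι.app i)) (A : Piece F) :
    IsOpenImmersion (A.leg c) := by
  have := hc A.idx
  unfold Piece.leg
  infer_instance

theorem isOpenImmersion_pieces_map [h : IsGluable F] {A B : Piece F} (f : A ⟶ B) :
    IsOpenImmersion ((pieces F).map f) := by
  obtain ⟨c, hc⟩ := h.exists_cocone
  have h1 := isOpenImmersion_leg c hc A
  have h2 := isOpenImmersion_leg c hc B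
  have h3 : IsOpenImmersion (f.mor ≫ B.leg c) := by rw [f.w]; exact h1
  exact IsOpenImmersion.of_comp f.mor (B.leg c)

theorem isThin_pieces [h : IsGluable F] : Quiver.IsThin (Piece F) := by
  obtain ⟨c, hc⟩ := h.exists_cocone
  intro A B
  refine ⟨fun f g => Piece.Hom.ext ?_⟩
  have := isOpenImmersion_leg c hc B
  rw [← cancel_mono (B.leg c)]
  exact (Piece.Hom.w f c).trans (Piece.Hom.w g c).symm

/-- Auxiliary: the inclusion of a smaller piece. -/
def Piece.incl (A : Piece F) (U : (F.obj A.idx).Opens) (hU : U ≤ A.opn) :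
    (⟨A.idx, U⟩ : Piece F) ⟶ A where
  mor := (F.obj A.idx).homOfLE hU
  w s := by simp [Piece.leg]

theorem isLocallyDirected_pieces [h : IsGluable F] :
    (pieces F ⋙ Scheme.forget).IsLocallyDirected := by
  refine ⟨fun {A B C} f g x y hxy => ?_⟩
  have hf := isOpenImmersion_pieces_map f
  have hg := isOpenImmersion_pieces_map g
  replace hxy : (pieces F).map f x = (pieces F).map g y := hxy
  let V : (A.opn : Scheme.{u}).Opens := (pieces F).map f ⁻¹ᵁ ((pieces F).map g).opensRange
  let U : (F.obj A.idx).Opens := A.opn.ι ''ᵁ V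
  have hUA : U ≤ A.opn := A.opn.ι_image_le V
  let D : Piece F := ⟨A.idx, U⟩
  let i : D ⟶ A := A.incl U hUA
  have hxV : x ∈ V := ⟨y, hxy.symm⟩
  have hi : Set.range ((pieces F).map i) = (V : Set (A.opn : Scheme.{u})) := by
    change Set.range ((F.obj A.idx).homOfLE hUA) = _
    have h1 := Scheme.opensRange_homOfLE hUA
    have h2 : A.opn.ι ⁻¹ᵁ U = V := Scheme.Hom.preimage_image_eq A.opn.ι V
    rw [h2] at h1
    exact congrArg (fun W : (A.opn : Scheme.{u}).Opens => (W : Set (A.opn : Scheme.{u}))) h1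
  have hr : Set.range ((pieces F).map i ≫ (pieces F).map f) ⊆ Set.range ((pieces F).map g) := by
    rintro _ ⟨z, rfl⟩
    have hz : (pieces F).map i z ∈ (V : Set (A.opn : Scheme.{u})) := hi ▸ ⟨z, rfl⟩
    rw [Scheme.Hom.comp_apply]
    exact hz
  let m : (pieces F).obj D ⟶ (pieces F).obj B :=
    IsOpenImmersion.lift ((pieces F).map g) ((pieces F).map i ≫ (pieces F).map f) hr
  have hm : m ≫ (pieces F).map g = (pieces F).map i ≫ (pieces F).map f :=
    IsOpenImmersion.lift_fac _ _ _
  let k : D ⟶ B := ⟨m, fun s => by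
    have e1 := congrArg (fun t => t ≫ C.leg s) hm
    have e2 := Category.assoc m g.mor (C.leg s)
    have e3 := Category.assoc i.mor f.mor (C.leg s)
    have e4 := congrArg (fun t => m ≫ t) (g.w s)
    have e5 := congrArg (fun t => i.mor ≫ t) (f.w s)
    exact e4.symm.trans (e2.symm.trans (e1.trans (e3.trans (e5.trans (i.w s)))))⟩
  obtain ⟨z, hz⟩ : x ∈ Set.range ((pieces F).map i) := hi ▸ hxV
  refine ⟨D, i, k, z, hz, ?_⟩
  apply (Scheme.Hom.isOpenEmbedding ((pieces F).map g)).injective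
  change (pieces F).map g (m z) = (pieces F).map g y
  rw [← Scheme.Hom.comp_apply, hm, Scheme.Hom.comp_apply, hz, hxy]

/-- Auxiliary: the piece given by a whole member of the diagram. -/
def Piece.whole (F : I ⥤ Scheme.{u}) (i : I) : Piece F := ⟨i, ⊤⟩

/-- Auxiliary: the piece given by a whole member is isomorphic to that member. -/
def wholeIso (F : I ⥤ Scheme.{u}) (i : I) : (pieces F).obj (Piece.whole F i) ≅ F.obj i :=
  (F.obj i).topIso

theorem wholeIso_hom_app (s : Cocone F) (i : I) :
    (wholeIso F i).hom ≫ s.ι.app i = (Piece.whole F i).leg s := rfl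

/-- Auxiliary: transition morphisms of the diagram as morphisms of pieces. -/
def Piece.trans {i j : I} (f : i ⟶ j) : Piece.whole F i ⟶ Piece.whole F j where
  mor := (wholeIso F i).hom ≫ F.map f ≫ (wholeIso F j).inv
  w s := by
    have e : ((wholeIso F i).hom ≫ F.map f ≫ (wholeIso F j).inv) ≫ (wholeIso F j).hom ≫
        s.ι.app j = (wholeIso F i).hom ≫ s.ι.app i := by simp
    exact e

theorem pieces_map_trans {i j : I} (f : i ⟶ j) :
    (pieces F).map (Piece.trans f) = (wholeIso F i).hom ≫ F.map f ≫ (wholeIso F j).inv := rfl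

/-- Auxiliary: the inclusion of a piece into the whole member. -/
def Piece.inclWhole (A : Piece F) : A ⟶ Piece.whole F A.idx where
  mor := (F.obj A.idx).homOfLE le_top
  w s := by
    have e : (F.obj A.idx).homOfLE (le_top : A.opn ≤ ⊤) ≫ (⊤ : (F.obj A.idx).Opens).ι ≫
        s.ι.app A.idx = A.opn.ι ≫ s.ι.app A.idx := by simp
    exact e

theorem pieces_map_incl (A : Piece F) :
    (pieces F).map A.inclWhole ≫ (wholeIso F A.idx).hom =
      A.opn.ι :=
  Scheme.homOfLE_ι (F.obj A.idx) (le_top : A.opn ≤ ⊤)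

/-- Auxiliary: a cocone on a diagram induces a cocone on its pieces. -/
def pieceCocone (s : Cocone F) : Cocone (pieces F) where
  pt := s.pt
  ι := { app := fun A => A.leg s
         naturality := fun _ _ f => (Piece.Hom.w f s).trans (Category.comp_id _).symm }

/-- Auxiliary: a cocone on the pieces restricts to a cocone on the diagram. -/
def restrictCocone (t : Cocone (pieces F)) : Cocone F where
  pt := t.pt
  ι := { app := fun i => (wholeIso F i).inv ≫ t.ι.app (Piece.whole F i)
         naturality := fun i j f => by
           have h := t.w (Piece.trans f)
           rw [pieces_map_trans, Category.assoc, Category.assoc, ← Iso.eq_inv_comp] at h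
           exact h.trans (Category.comp_id _).symm }

/-- Auxiliary: restriction preserves colimits. -/
def isColimitRestrictCocone (t : Cocone (pieces F)) (ht : IsColimit t) :
    IsColimit (restrictCocone t) where
  desc s := ht.desc (pieceCocone s)
  fac s i := by
    change ((wholeIso F i).inv ≫ t.ι.app _) ≫ ht.desc (pieceCocone s) = s.ι.app i
    rw [Category.assoc, ht.fac]
    exact (Iso.inv_comp_eq (wholeIso F i)).mpr (wholeIso_hom_app s i).symm
  uniq s m hm := by
    refine ht.uniq (pieceCocone s) m fun A => ?_
    have hA := t.w A.inclWhole
    have h1 : (wholeIso F A.idx).inv ≫ t.ι.app (Piece.whole F A.idx) ≫ m = s.ι.app A.idx :=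
      (Category.assoc _ _ _).symm.trans (hm A.idx)
    rw [Iso.inv_comp_eq] at h1
    rw [← hA]
    refine (Category.assoc _ _ _).trans ((congrArg _ h1).trans ?_)
    refine (Category.assoc _ _ _).symm.trans ?_
    rw [pieces_map_incl]
    rfl

theorem exists_isColimit [h : IsGluable F] :
    ∃ c : Cocone F, Nonempty (IsColimit c) ∧ ∀ i, IsOpenImmersion (c.ι.app i) := by
  have h1 : ∀ {A B : Piece F} (f : A ⟶ B), IsOpenImmersion ((pieces F).map f) :=
    fun f => isOpenImmersion_pieces_map f
  have h2 : Quiver.IsThin (Piece F) := isThin_pieces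
  have h3 : (pieces F ⋙ Scheme.forget).IsLocallyDirected := isLocallyDirected_pieces
  have h4 : Small.{u} (Piece F) := by
    let e : Piece F → Σ i : I, (F.obj i).Opens := fun A => ⟨A.idx, A.opn⟩
    have he : Function.Injective e := by
      rintro ⟨i, U⟩ ⟨j, V⟩ h
      obtain ⟨rfl, h⟩ := Sigma.mk.inj_iff.mp h
      obtain rfl := eq_of_heq h
      rfl
    exact small_of_injective he
  refine ⟨restrictCocone (colimit.cocone (pieces F)),
    ⟨isColimitRestrictCocone _ (colimit.isColimit _)⟩, fun i => ?_⟩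
  have : IsOpenImmersion ((wholeIso F i).inv ≫ colimit.ι (pieces F) (Piece.whole F i)) :=
    inferInstance
  exact this

/-- The inductive limit of a gluable diagram exists. -/
instance hasColimit_of_isGluable [IsGluable F] : HasColimit F := by
  obtain ⟨c, ⟨hc⟩, -⟩ := exists_isColimit (F := F)
  exact ⟨c, hc⟩

/-- The canonical morphisms to the inductive limit of a gluable diagram are open immersions. -/
instance isOpenImmersion_colimit_ι [IsGluable F] (i : I) : IsOpenImmersion (colimit.ι F i) := by
  obtain ⟨c, ⟨hc⟩, h⟩ := exists_isColimit (F := F)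
  have := h i
  have h2 : IsOpenImmersion (c.ι.app i ≫ (hc.coconePointUniqueUpToIso (colimit.isColimit F)).hom) :=
    inferInstance
  have h3 := hc.comp_coconePointUniqueUpToIso_hom (colimit.isColimit F) i
  change c.ι.app i ≫ _ = colimit.ι F i at h3
  rwa [h3] at h2

end Gluing

section Construction

variable {I : Type u} [SemilatticeInf I]

/-- Any two of the charts below a given one, seen as open subschemes of it, meet exactly in
the chart of the infimum. Then the system can be glued. -/
theorem isGluable_of_inf (M : Iᵒᵖ ⥤ AddCommMonCat.{u}) (hM : OpenlyImmersive M)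
    (h : ∀ ⦃i a b : I⦄ (ha : a ≤ i) (hb : b ≤ i),
      Set.range ((charts M).map (homOfLE ha)) ∩ Set.range ((charts M).map (homOfLE hb)) ⊆
        Set.range ((charts M).map (homOfLE (inf_le_left.trans ha : a ⊓ b ≤ i)))) :
    IsGluable (charts M) := by
  have h1 : ∀ {i j : I} (f : i ⟶ j), IsOpenImmersion ((charts M).map f) :=
    fun f => hM (leOfHom f)
  have h2 : (charts M ⋙ Scheme.forget).IsLocallyDirected := by
    refine ⟨fun {a b i} f g x y hxy => ?_⟩
    replace hxy : (charts M).map f x = (charts M).map g y := hxy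
    obtain ⟨z, hz⟩ := h (leOfHom f) (leOfHom g) ⟨⟨x, rfl⟩, ⟨y, hxy.symm⟩⟩
    refine ⟨a ⊓ b, homOfLE inf_le_left, homOfLE inf_le_right, z, ?_, ?_⟩
    · apply (Scheme.Hom.isOpenEmbedding ((charts M).map f)).injective
      change (charts M).map f ((charts M).map _ z) = (charts M).map f x
      rw [← Scheme.Hom.comp_apply, ← Functor.map_comp]
      exact hz
    · apply (Scheme.Hom.isOpenEmbedding ((charts M).map g)).injective
      change (charts M).map g ((charts M).map _ z) = (charts M).map g y
      rw [← Scheme.Hom.comp_apply, ← Functor.map_comp, ← hxy]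
      exact hz
  exact ⟨⟨colimit.cocone (charts M), fun i => inferInstanceAs (IsOpenImmersion (colimit.ι _ i))⟩⟩

/-- The scheme `X_M(ℤ)`: the inductive limit of the affine schemes `Spec ℤ[M_i]`. -/
def XInt (M : Iᵒᵖ ⥤ AddCommMonCat.{u}) [IsGluable (charts M)] : Scheme.{u} :=
  colimit (charts M)

/-- The scheme `X_M(S) = X_M(ℤ) × S`, the product in the category of schemes. -/
def X (M : Iᵒᵖ ⥤ AddCommMonCat.{u}) [IsGluable (charts M)] (S : Scheme.{u}) : Scheme.{u} :=
  pullback (terminal.from (XInt M)) (terminal.from S)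

end Construction

/-- All stalks of the structure sheaf are noetherian rings. -/
def PointwiseNoetherian (S : Scheme.{u}) : Prop :=
  ∀ x : S, IsNoetherianRing (S.presheaf.stalk x)

/-- The underlying topological space is noetherian. -/
def TopologicallyNoetherian (S : Scheme.{u}) : Prop :=
  NoetherianSpace S

/-- The underlying topological space is locally noetherian: every point has a neighbourhood that
is a noetherian space. -/
def TopologicallyLocallyNoetherian (S : Scheme.{u}) : Prop :=
  ∀ x : S, ∃ U ∈ 𝓝 x, NoetherianSpace U

/-- The underlying topological space is a Jacobson space. -/
def Jacobsonian (S : Scheme.{u}) : Prop :=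
  JacobsonSpace S

end

end MonoidGluing

/-!
Let `i` be an index. The scheme `X_M(S)` is covered by the open subschemes `Spec ℤ[M_i] × S`, which
are affine over `S` (`prodCover`), and the augmentation `ℤ[M_i] → ℤ` yields a section of
`Spec ℤ[M_i] × S → S`, which is a closed immersion (`isClosedImmersion_chartSection`). So if `I` is
nonempty, `S` is a closed subscheme of an open subscheme of `X_M(S)`, and all the properties in
question pass from `X_M(S)` to `S`.

If `M` is of finite type, then `X_M(S) → S` is locally of finite type (`locallyOfFiniteType_proj`),
and it is quasi-compact if `I` is finite (`quasiCompact_proj`). So the converses are forms of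
Hilbert's basis theorem and of the Nullstellensatz. The form needed for noetherian topological
spaces is the theorem of Ohm and Pendleton that `Spec R[X]` is noetherian if `Spec R` is
(`PrimeSpectrum.noetherianSpace_polynomial`).

It remains to see that `M` is of finite type if `X_M(S)` is locally noetherian and `S` is nonempty.
For a nonempty affine open subscheme `Spec R` of `S` the ring `R[M_i]` is noetherian
(`isNoetherianRing_addMonoidAlgebra`). Hence the congruences on `M_i` satisfy the ascending chain
condition, and Budach's theorem (`AddCon.fg_of_wellFoundedGT_addCon`) shows that `M_i` is finitely
generated.
-/

/-! ### The topological Hilbert basis theorem -/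

namespace PrimeSpectrum

open TopologicalSpace Polynomial

/-- The family of ideals whose complementary open set in the spectrum is quasi-compact is an Oka
family, so that an ideal maximal outside of it is prime. -/
theorem isOka_isCompact_compl_zeroLocus (A : Type*) [CommRing A] :
    Ideal.IsOka fun I : Ideal A => IsCompact (zeroLocus (I : Set A))ᶜ where
  top := by simpa using isCompact_univ
  oka {I a} h1 h2 := by
    have e1 : (zeroLocus ((I ⊔ Ideal.span {a} : Ideal A) : Set A))ᶜ \ basicOpen a =
        (zeroLocus (I : Set A))ᶜ \ basicOpen a := by
      rw [zeroLocus_sup, zeroLocus_span, Set.compl_inter, basicOpen_eq_zeroLocus_compl]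
      ext x
      simp only [Set.mem_sdiff, Set.mem_union, Set.mem_compl_iff]
      tauto
    have e2 : (zeroLocus (I.colon (Ideal.span {a} : Ideal A) : Set A))ᶜ ∩ basicOpen a =
        (zeroLocus (I : Set A))ᶜ ∩ basicOpen a := by
      ext q
      simp only [Set.mem_inter_iff, Set.mem_compl_iff, mem_zeroLocus, SetLike.mem_coe,
        mem_basicOpen]
      refine and_congr_left fun ha => not_congr ⟨fun h x hx => h ?_, fun h x hx => ?_⟩
      · exact Ideal.le_colon hx
      · have hx' : x * a ∈ I := Ideal.mem_colon_span_singleton.1 hx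
        exact (q.2.mem_or_mem (h hx')).resolve_right ha
    have h3 : IsCompact ((zeroLocus (I : Set A))ᶜ \ basicOpen a) :=
      e1 ▸ h1.diff (basicOpen a).isOpen
    have h4 : IsCompact ((zeroLocus (I : Set A))ᶜ ∩ basicOpen a) :=
      e2 ▸ h2.inter_of_isOpen (isCompact_basicOpen a) (isClosed_zeroLocus _).isOpen_compl
        (basicOpen a).isOpen
    have h5 := h3.union h4
    rwa [Set.sdiff_union_inter] at h5

/-- A topological form of Cohen's theorem: the spectrum is noetherian if the complementary open
set of a prime ideal is quasi-compact as soon as this holds for all larger ideals. -/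
theorem noetherianSpace_of_forall_isPrime (A : Type*) [CommRing A]
    (h : ∀ P : Ideal A, P.IsPrime →
      (∀ Q : Ideal A, P < Q → IsCompact (zeroLocus (Q : Set A))ᶜ) →
        IsCompact (zeroLocus (P : Set A))ᶜ) :
    NoetherianSpace (PrimeSpectrum A) := by
  have key : ∀ I : Ideal A, IsCompact (zeroLocus (I : Set A))ᶜ := by
    by_contra! hne
    obtain ⟨I, hI⟩ := hne
    obtain ⟨M, -, hM⟩ := zorn_le_nonempty₀ {I : Ideal A | ¬ IsCompact (zeroLocus (I : Set A))ᶜ}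
      (fun C hC hchain J hJ => by
        refine ⟨sSup C, fun hcomp => ?_, fun _ => le_sSup⟩
        have hdir : DirectedOn (· ≤ ·) C := hchain.directedOn
        -- the open set of `sSup C` is the directed union of those of the members
        have hsub : (zeroLocus ((sSup C : Ideal A) : Set A))ᶜ ⊆
            ⋃ K : C, (zeroLocus ((K : Ideal A) : Set A))ᶜ := by
          intro q hq
          by_contra hq'
          simp only [Set.mem_iUnion, Set.mem_compl_iff, not_exists, not_not] at hq'
          exact hq (sSup_le fun K hK => hq' ⟨K, hK⟩ : sSup C ≤ q.asIdeal)
        have : Nonempty C := ⟨⟨J, hJ⟩⟩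
        obtain ⟨K, hK⟩ := hcomp.elim_directed_cover
          (fun K : C => (zeroLocus ((K : Ideal A) : Set A))ᶜ)
          (fun K => (isClosed_zeroLocus _).isOpen_compl) hsub (by
            rintro ⟨K, hK⟩ ⟨L, hL⟩
            obtain ⟨N, hN, h1, h2⟩ := hdir K hK L hL
            exact ⟨⟨N, hN⟩, Set.compl_subset_compl.2 (zeroLocus_anti_mono h1),
              Set.compl_subset_compl.2 (zeroLocus_anti_mono h2)⟩)
        refine hC K.2 ?_
        have : (zeroLocus ((K : Ideal A) : Set A))ᶜ = (zeroLocus ((sSup C : Ideal A) : Set A))ᶜ :=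
          (Set.compl_subset_compl.2
            (zeroLocus_anti_mono_ideal (le_sSup K.2 : (K : Ideal A) ≤ sSup C))).antisymm hK
        rwa [this]) I hI
    have hP := (isOka_isCompact_compl_zeroLocus A).isPrime_of_maximal_not hM
    exact hM.prop (h M hP fun Q hQ => not_not.1 (hM.not_prop_of_gt hQ))
  refine noetherianSpace_iff_opens _ |>.2 fun U => ?_
  obtain ⟨I, hI⟩ := (isClosed_iff_zeroLocus_ideal _).1 U.isOpen.isClosed_compl
  have := key I
  rwa [← hI, compl_compl] at this

/-- The topological Hilbert basis theorem of Ohm and Pendleton. Let `P` be a prime ideal of `R[X]`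
with `p = P ∩ R`, and let `f ∈ P` have least degree outside of `p[X]`, with leading coefficient `c`.
Pseudo-division by `f` shows that `P` and `p[X] + (f)` have the same zeros where `c ≠ 0`, whereas
the locus `c = 0` is controlled by the larger ideal `P + (c)`. -/
theorem noetherianSpace_polynomial (R : Type*) [CommRing R] [NoetherianSpace (PrimeSpectrum R)] :
    NoetherianSpace (PrimeSpectrum R[X]) := by
  refine noetherianSpace_of_forall_isPrime _ fun P hP hlarger => ?_
  let pX : Ideal R[X] := (P.comap (C : R →+* R[X])).map C
  have hle : pX ≤ P := Ideal.map_comap_le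
  have hpX : IsCompact (zeroLocus (pX : Set R[X]))ᶜ := by
    have h1 : IsCompact (zeroLocus ((P.comap (C : R →+* R[X]) : Ideal R) : Set R))ᶜ :=
      NoetherianSpace.isCompact _
    obtain ⟨J, hJ, e⟩ := isCompact_isOpen_iff_ideal.1
      ⟨h1, (isClosed_zeroLocus _).isOpen_compl⟩
    refine (isCompact_isOpen_iff_ideal.2 ⟨J.map C, hJ.map _, ?_⟩).1
    have e' := congrArg (fun s => (comap (C : R →+* R[X])) ⁻¹' s) e
    simpa [Set.preimage_compl, preimage_comap_zeroLocus, pX, Ideal.map, zeroLocus_span] using e'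
  by_cases hPp : P ≤ pX
  · rwa [le_antisymm hPp hle]
  -- a polynomial of least degree in `P` outside of `(P ∩ R)[X]`
  obtain ⟨f, ⟨hfP, hfp⟩, hmin⟩ : ∃ f ∈ {f | f ∈ P ∧ f ∉ pX}, ∀ g ∈ {f | f ∈ P ∧ f ∉ pX},
      f.natDegree ≤ g.natDegree := by
    obtain ⟨g, hg, hg'⟩ := Set.not_subset.1 hPp
    have hne : {f | f ∈ P ∧ f ∉ pX}.Nonempty := ⟨g, hg, hg'⟩
    exact ⟨_, Function.argminOn_mem natDegree _ hne,
      fun g hg => Function.argminOn_le natDegree _ hg⟩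
  let c := f.leadingCoeff
  have hmin' : ∀ g ∈ P, g.natDegree < f.natDegree → g ∈ pX := fun g hg hd => by
    by_contra h
    exact absurd (hmin g ⟨hg, h⟩) (not_le.2 hd)
  have hc : C c ∉ P := fun hcP => by
    have hcp : C c ∈ pX := Ideal.mem_map_of_mem _ (Ideal.mem_comap.2 hcP)
    have hlead : C c * X ^ f.natDegree ∈ pX := Ideal.mul_mem_right _ _ hcp
    have he : f.eraseLead = f - C c * X ^ f.natDegree := by
      rw [← self_sub_C_mul_X_pow]
    refine hfp ?_
    have : f.eraseLead ∈ pX := by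
      rcases f.eraseLead_natDegree_lt_or_eraseLead_eq_zero with h | h
      · exact hmin' _ (he ▸ sub_mem hfP (hle hlead)) h
      · rw [h]; exact zero_mem _
    rw [he] at this
    simpa using add_mem this hlead
  -- pseudo-division by `f`
  have hdiv : ∀ q : PrimeSpectrum R[X], pX ≤ q.asIdeal → f ∈ q.asIdeal → C c ∉ q.asIdeal →
      P ≤ q.asIdeal := by
    intro q hq hfq hcq g hg
    induction hn : g.natDegree using Nat.strong_induction_on generalizing g with
    | _ n ih =>
      by_cases hd : g.natDegree < f.natDegree
      · exact hq (hmin' g hg hd)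
      · have hcl : f.cancelLeads g ∈ q.asIdeal := by
          have hclP : f.cancelLeads g ∈ P :=
            sub_mem (Ideal.mul_mem_left _ _ hg) (Ideal.mul_mem_left _ _ hfP)
          by_cases h0 : g.natDegree = 0
          · have : f.natDegree = 0 := by omega
            exfalso
            apply hc
            have : f = C c := by
              rw [eq_C_of_natDegree_eq_zero this]
              simp [c, leadingCoeff, this]
            rwa [← this]
          · exact ih _ (hn ▸ natDegree_cancelLeads_lt_of_natDegree_le_natDegree (not_lt.1 hd)
              (Nat.pos_of_ne_zero h0)) hclP rfl
        have h1 : C c * g ∈ q.asIdeal := by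
          have h2 : C g.leadingCoeff * X ^ (g.natDegree - f.natDegree) * f ∈ q.asIdeal :=
            Ideal.mul_mem_left _ _ hfq
          have h3 := add_mem hcl h2
          have h4 : f.natDegree - g.natDegree = 0 := by omega
          rw [cancelLeads, sub_add_cancel, h4] at h3
          simpa [c] using h3
        exact (q.2.mem_or_mem h1).resolve_left hcq
  have h1 : IsCompact ((zeroLocus (P : Set R[X]))ᶜ \ basicOpen (C c)) := by
    have hlt : P < P ⊔ Ideal.span {C c} := Submodule.lt_sup_iff_notMem.2 hc
    convert (hlarger _ hlt).diff (basicOpen (C c)).isOpen using 1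
    rw [zeroLocus_sup, zeroLocus_span, Set.compl_inter, basicOpen_eq_zeroLocus_compl]
    ext x
    simp only [Set.mem_sdiff, Set.mem_union, Set.mem_compl_iff]
    tauto
  have h2 : IsCompact ((zeroLocus (P : Set R[X]))ᶜ ∩ basicOpen (C c)) := by
    have h3 : IsCompact ((zeroLocus (pX : Set R[X]))ᶜ ∪ basicOpen f) :=
      hpX.union (isCompact_basicOpen f)
    convert h3.inter_of_isOpen (isCompact_basicOpen (C c))
      ((isClosed_zeroLocus _).isOpen_compl.union (basicOpen f).isOpen) (basicOpen _).isOpen using 1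
    ext q
    simp only [Set.mem_inter_iff, Set.mem_union, Set.mem_compl_iff, SetLike.mem_coe, mem_basicOpen,
      mem_zeroLocus]
    refine and_congr_left fun hcq => ⟨fun h => ?_, fun h hPq => ?_⟩
    · by_contra! h'
      exact h (hdiv q h'.1 h'.2 hcq)
    · rcases h with h | h
      · exact h (hle.trans hPq)
      · exact h (hPq hfP)
  have h3 := h1.union h2
  rwa [Set.sdiff_union_inter] at h3

theorem noetherianSpace_mvPolynomial (R : Type*) [CommRing R] [NoetherianSpace (PrimeSpectrum R)]
    (n : ℕ) : NoetherianSpace (PrimeSpectrum (MvPolynomial (Fin n) R)) := by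
  induction n with
  | zero =>
    exact (noetherianSpace_iff_of_homeomorph
      (homeomorphOfRingEquiv (MvPolynomial.isEmptyRingEquiv R (Fin 0)))).2 inferInstance
  | succ n ih =>
    exact (noetherianSpace_iff_of_homeomorph
      (homeomorphOfRingEquiv (MvPolynomial.finSuccEquiv R n).toRingEquiv)).2
      (noetherianSpace_polynomial _)

theorem noetherianSpace_of_finiteType (R A : Type*) [CommRing R] [CommRing A] [Algebra R A]
    [Algebra.FiniteType R A] [NoetherianSpace (PrimeSpectrum R)] :
    NoetherianSpace (PrimeSpectrum A) := by
  obtain ⟨n, f, hf⟩ := Algebra.FiniteType.iff_quotient_mvPolynomial''.1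
    (inferInstance : Algebra.FiniteType R A)
  have := noetherianSpace_mvPolynomial R n
  exact (isClosedEmbedding_comap_of_surjective _ f.toRingHom hf).isInducing.noetherianSpace

end PrimeSpectrum

namespace AddCon

/-! ### Congruences of commutative monoids -/

section Congruences

variable {M : Type*} [AddCommMonoid M]

/-- The Rees congruence of the principal ideal `s + M`: it identifies all elements of `s + M` and
no others. -/
def rees (s : M) : AddCon M where
  r a b := a = b ∨ (∃ x, a = s + x) ∧ ∃ y, b = s + y
  iseqv := by
    refine ⟨fun a => Or.inl rfl, ?_, ?_⟩
    · rintro a b (rfl | ⟨h1, h2⟩)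
      · exact Or.inl rfl
      · exact Or.inr ⟨h2, h1⟩
    · rintro a b c (rfl | ⟨h1, h2⟩) (rfl | ⟨h3, h4⟩)
      · exact Or.inl rfl
      · exact Or.inr ⟨h3, h4⟩
      · exact Or.inr ⟨h1, h2⟩
      · exact Or.inr ⟨h1, h4⟩
  add' := by
    rintro a b c d (rfl | ⟨⟨x, rfl⟩, ⟨y, rfl⟩⟩) (rfl | ⟨⟨z, rfl⟩, ⟨w, rfl⟩⟩)
    · exact Or.inl rfl
    · exact Or.inr ⟨⟨a + z, by abel⟩, ⟨a + w, by abel⟩⟩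
    · exact Or.inr ⟨⟨x + c, by abel⟩, ⟨y + c, by abel⟩⟩
    · exact Or.inr ⟨⟨x + (s + z), by abel⟩, ⟨y + (s + w), by abel⟩⟩

/-- The congruence identifying elements that agree after adding `s`. -/
def cancel (s : M) : AddCon M where
  r a b := a + s = b + s
  iseqv := ⟨fun _ => rfl, Eq.symm, Eq.trans⟩
  add' {a b c d} h1 h2 := by
    rw [add_assoc, h2, add_left_comm, h1, add_left_comm, add_assoc]

theorem cancel_rel {s a b : M} : cancel s a b ↔ a + s = b + s := Iff.rfl

/-- The congruence identifying elements that agree up to adding multiples of `g`; for a unit `g`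
these are the orbits of translation by `g`. -/
def shift (g : M) : AddCon M where
  r a b := ∃ n m : ℕ, a + n • g = b + m • g
  iseqv := by
    refine ⟨fun a => ⟨0, 0, rfl⟩, fun ⟨n, m, h⟩ => ⟨m, n, h.symm⟩, ?_⟩
    rintro a b c ⟨n, m, h⟩ ⟨p, q, h'⟩
    refine ⟨n + p, q + m, ?_⟩
    rw [add_nsmul, add_nsmul, ← add_assoc, ← add_assoc, h, ← h', add_right_comm]
  add' := by
    rintro a b c d ⟨n, m, h⟩ ⟨p, q, h'⟩
    refine ⟨n + p, m + q, ?_⟩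
    rw [add_nsmul, add_nsmul, add_add_add_comm, h, h', add_add_add_comm]

/-- Generators of a quotient lift: a finitely generated submonoid meets every class. -/
theorem exists_fg_of_quotient_fg (c : AddCon M) [h : AddMonoid.FG c.Quotient] :
    ∃ T : AddSubmonoid M, T.FG ∧ ∀ a, ∃ t ∈ T, c t a := by
  obtain ⟨S, hS, hfin⟩ := (AddSubmonoid.fg_iff _).1 ((AddMonoid.fg_def).1 h)
  have hsurj : Function.Surjective (c.mk' : M →+ c.Quotient) := AddCon.mk'_surjective
  refine ⟨AddSubmonoid.closure (Function.surjInv hsurj '' S),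
    (AddSubmonoid.fg_iff _).2 ⟨_, rfl, hfin.image _⟩, fun a => ?_⟩
  have ha : c.mk' a ∈ (AddSubmonoid.closure (Function.surjInv hsurj '' S)).map c.mk' := by
    rw [AddMonoidHom.map_mclosure, Set.image_image]
    simp only [Function.surjInv_eq hsurj, Set.image_id', hS]
    trivial
  obtain ⟨t, ht, hta⟩ := ha
  exact ⟨t, ht, (AddCon.eq c).1 hta⟩

end Congruences

/-! ### Noetherian monoid rings and finite generation of monoids -/

section Budach

variable {Q : Type*} [AddCommMonoid Q]

/-- The inductive step of Budach's theorem: only the trivial congruence is left to treat. If some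
`s` is neither cancellable nor absorbing, generators of `Q` are found from the quotients by
`cancel s` (which gives `s + Q`) and by `rees s` (which gives the rest). Otherwise all elements
apart from a possible absorbing one are cancellable. If one of these, `s`, is not a unit, then
`rees s` gives generators outside of `s + Q`, and subtracting `s` terminates by the chain condition.
If all are units, the quotient by the translations by one unit `g ≠ 0` suffices. -/
theorem fg_of_forall_ne_bot [hwf : WellFoundedGT (AddCon Q)]
    (h : ∀ c : AddCon Q, c ≠ ⊥ → AddMonoid.FG c.Quotient) : AddMonoid.FG Q := by
  replace h : ∀ c : AddCon Q, ∀ a b, c a b → a ≠ b →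
      ∃ T : AddSubmonoid Q, T.FG ∧ ∀ a, ∃ t ∈ T, c t a := fun c a b hab hne => by
    have : AddMonoid.FG c.Quotient := h c fun hc => by
      rw [hc] at hab
      exact hne hab
    exact AddCon.exists_fg_of_quotient_fg c
  have fg_of {T : AddSubmonoid Q} (hT : T.FG) (hx : ∀ x, x ∈ T) : AddMonoid.FG Q := by
    rw [AddMonoid.fg_def, ← (AddSubmonoid.eq_top_iff' T).2 hx]
    exact hT
  have fg_closure {s : Set Q} (hs : s.Finite) : (AddSubmonoid.closure s).FG :=
    (AddSubmonoid.fg_iff _).2 ⟨s, rfl, hs⟩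
  by_cases hA : ∃ s : Q, (∃ a b, a + s = b + s ∧ a ≠ b) ∧ ∃ y, s + y ≠ s
  · obtain ⟨s, ⟨a, b, hab, hne⟩, y, hy⟩ := hA
    obtain ⟨T, hT, hT'⟩ := h (cancel s) a b hab hne
    obtain ⟨U, hU, hU'⟩ := h (rees s) (s + y) s (Or.inr ⟨⟨y, rfl⟩, 0, (add_zero s).symm⟩) hy
    refine fg_of ((hT.sup hU).sup (fg_closure (Set.finite_singleton s))) fun x => ?_
    obtain ⟨u, hu, rfl | ⟨-, z, rfl⟩⟩ := hU' x
    · exact AddSubmonoid.mem_sup_left (AddSubmonoid.mem_sup_right hu)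
    · obtain ⟨t, ht, htz⟩ := hT' z
      rw [cancel_rel] at htz
      rw [add_comm, ← htz]
      exact add_mem (AddSubmonoid.mem_sup_left (AddSubmonoid.mem_sup_left ht))
        (AddSubmonoid.mem_sup_right (AddSubmonoid.subset_closure rfl))
  -- now every element is cancellable or absorbing
  have hdich : ∀ s : Q, (∀ a b, a + s = b + s → a = b) ∨ ∀ y, s + y = s := by
    intro s
    by_contra! hs
    exact hA ⟨s, hs.1, hs.2⟩
  let Z : Set Q := {z | ∀ y, z + y = z}
  have hZ : Z.Finite := Set.Subsingleton.finite fun z hz w hw => by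
    rw [← hz w, add_comm, hw z]
  by_cases hB : ∃ s : Q, s ∉ Z ∧ ∀ t, s + t ≠ 0
  · obtain ⟨s, hsZ, hs⟩ := hB
    have hsc : ∀ a b, a + s = b + s → a = b := (hdich s).resolve_right hsZ
    have hne : s + s ≠ s := fun hss => hs 0 <| by
      rw [add_zero]
      exact hsc s 0 (by rw [hss, zero_add])
    obtain ⟨T, hT, hT'⟩ := h (rees s) (s + s) s
      (Or.inr ⟨⟨s, rfl⟩, 0, (add_zero s).symm⟩) hne
    refine fg_of ((hT.sup (fg_closure hZ)).sup (fg_closure (Set.finite_singleton s))) fun x => ?_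
    -- noetherian induction on the principal ideal of `x`
    induction x using (InvImage.wf (rees (M := Q)) hwf.wf).induction with
    | _ x ih =>
      by_cases hxZ : x ∈ Z
      · exact AddSubmonoid.mem_sup_left
          (AddSubmonoid.mem_sup_right (AddSubmonoid.subset_closure hxZ))
      obtain ⟨t, ht, rfl | ⟨-, y, rfl⟩⟩ := hT' x
      · exact AddSubmonoid.mem_sup_left (AddSubmonoid.mem_sup_left ht)
      refine add_mem (AddSubmonoid.mem_sup_right (AddSubmonoid.subset_closure rfl)) (ih y ?_)
      have hy : ∀ a b, a + y = b + y → a = b := (hdich y).resolve_right fun hy => hxZ (by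
        rw [add_comm, hy s]
        exact hy)
      -- cancelling `y` shows that `y + Q` is strictly larger than `s + y + Q`
      have hny : ∀ x, y ≠ s + y + x := fun x hx => hs x (hy _ _ (by
        rw [zero_add]
        nth_rw 2 [hx]
        abel))
      refine lt_of_le_not_ge ?_ fun hle => ?_
      · rintro a b (rfl | ⟨⟨u, rfl⟩, v, rfl⟩)
        · exact Or.inl rfl
        · exact Or.inr ⟨⟨s + u, by abel⟩, s + v, by abel⟩
      · have h1 : rees y y (s + y) := Or.inr ⟨⟨0, (add_zero y).symm⟩, s, add_comm _ _⟩
        rcases hle h1 with h2 | ⟨⟨x, hx⟩, -⟩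
        · exact hny 0 (by rwa [add_zero])
        · exact hny x hx
  -- now every element is a unit or absorbing
  push Not at hB
  by_cases hC : ∃ g : Q, g ∉ Z ∧ g ≠ 0
  · obtain ⟨g, hgZ, hg⟩ := hC
    obtain ⟨g', hg'⟩ := hB g hgZ
    obtain ⟨T, hT, hT'⟩ := h (shift g) g 0 ⟨0, 1, by simp⟩ hg
    refine fg_of (hT.sup (fg_closure (s := {g, g'}) (by simp))) fun x => ?_
    obtain ⟨t, ht, n, m, hnm⟩ := hT' x
    have hx : x = t + (n • g + m • g') := by
      rw [← add_assoc, hnm, add_assoc, ← nsmul_add, hg', nsmul_zero, add_zero]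
    rw [hx]
    exact add_mem (AddSubmonoid.mem_sup_left ht) (AddSubmonoid.mem_sup_right
      (add_mem (nsmul_mem (AddSubmonoid.subset_closure (by simp)) n)
        (nsmul_mem (AddSubmonoid.subset_closure (by simp)) m)))
  · push Not at hC
    refine fg_of (fg_closure hZ) fun x => ?_
    by_cases hx : x ∈ Z
    · exact AddSubmonoid.subset_closure hx
    · rw [hC x hx]
      exact zero_mem _

/-- Budach's theorem: a commutative monoid with the ascending chain condition on congruences is
finitely generated. -/
theorem fg_of_wellFoundedGT_addCon (M : Type*) [AddCommMonoid M]
    [hwf : WellFoundedGT (AddCon M)] : AddMonoid.FG M := by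
  have key : ∀ c : AddCon M, AddMonoid.FG c.Quotient := by
    intro c
    induction c using hwf.wf.induction with
    | _ c ih =>
      have hsurj : Function.Surjective (c.mk' : M →+ c.Quotient) := AddCon.mk'_surjective
      let F : AddCon c.Quotient → AddCon M := fun d => d.comap c.mk' (map_add c.mk')
      have hF : ∀ {d e : AddCon c.Quotient}, F d ≤ F e → d ≤ e := by
        intro d e hde x y hxy
        obtain ⟨x, rfl⟩ := hsurj x
        obtain ⟨y, rfl⟩ := hsurj y
        exact hde hxy
      have hF' : StrictMono F := fun d e hde =>
        lt_of_le_not_ge (fun x y hxy => hde.le hxy) fun hle => hde.not_ge (hF hle)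
      have : WellFoundedGT (AddCon c.Quotient) := hF'.wellFoundedGT
      refine fg_of_forall_ne_bot fun d hd => ?_
      have hlt : c < F d := lt_of_le_of_ne
        (fun x y hxy => by
          change d (c.mk' x) (c.mk' y)
          rw [show c.mk' x = c.mk' y from (AddCon.eq c).2 hxy]
          exact d.refl _)
        fun hc => hd <| le_bot_iff.1 <| hF (hc.symm.le.trans fun x y hxy => (AddCon.eq c).2 hxy)
      have := ih (F d) hlt
      exact AddMonoid.fg_of_surjective (AddCon.comapQuotientEquivOfSurj d c.mk' hsurj).toAddMonoidHom
        (AddCon.comapQuotientEquivOfSurj d c.mk' hsurj).surjective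
  have := key ⊥
  exact AddMonoid.fg_of_surjective (AddCon.lift (⊥ : AddCon M) (AddMonoidHom.id M) bot_le)
    (fun x => ⟨(x : (⊥ : AddCon M).Quotient), rfl⟩)

/-- Congruences on `M` embed into ideals of `R[M]`, a congruence being recovered from the kernel
of `R[M] → R[M/c]`. -/
theorem fg_of_isNoetherianRing_addMonoidAlgebra (R M : Type*) [CommRing R] [Nontrivial R]
    [AddCommMonoid M] [IsNoetherianRing (AddMonoidAlgebra R M)] : AddMonoid.FG M := by
  let F : AddCon M → Ideal (AddMonoidAlgebra R M) := fun c =>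
    RingHom.ker (AddMonoidAlgebra.mapDomainRingHom R c.mk')
  have hmem : ∀ (c : AddCon M) (a b : M),
      AddMonoidAlgebra.single a (1 : R) - AddMonoidAlgebra.single b 1 ∈ F c ↔ c a b := by
    intro c a b
    rw [RingHom.mem_ker, map_sub, sub_eq_zero]
    simp only [AddMonoidAlgebra.mapDomainRingHom_apply, AddMonoidAlgebra.mapDomain_single]
    rw [AddMonoidAlgebra.single_left_inj one_ne_zero]
    exact AddCon.eq c
  have hmono : Monotone F := by
    intro c d hcd x hx
    have h : (d.mk' : M →+ d.Quotient) = (AddCon.map c d hcd).comp c.mk' := rfl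
    simp only [F, RingHom.mem_ker] at hx ⊢
    rw [h, AddMonoidAlgebra.mapDomainRingHom_comp, RingHom.comp_apply, hx, map_zero]
  have hF : StrictMono F := fun c d hcd =>
    lt_of_le_not_ge (hmono hcd.le) fun hle => hcd.not_ge fun a b hab =>
      (hmem c a b).1 (hle ((hmem d a b).2 hab))
  have : WellFoundedGT (AddCon M) := hF.wellFoundedGT
  exact fg_of_wellFoundedGT_addCon M

end Budach

end AddCon

namespace MonoidGluing

open CategoryTheory CategoryTheory.Limits AlgebraicGeometry Opposite TopologicalSpace Topology

/-! ### Morphisms locally of finite type and noetherian topological spaces -/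

section Topology

theorem TopologicallyLocallyNoetherian.of_isInducing {X Y : Scheme.{u}} (f : X ⟶ Y)
    (hf : IsInducing f) (hY : TopologicallyLocallyNoetherian Y) :
    TopologicallyLocallyNoetherian X := by
  intro x
  obtain ⟨U, hU, hU'⟩ := hY (f x)
  exact ⟨f ⁻¹' U, f.continuous.continuousAt hU,
    IsInducing.noetherianSpace (i := U.restrictPreimage f) (hf.restrictPreimage U)⟩

theorem TopologicallyNoetherian.topologicallyLocallyNoetherian {X : Scheme.{u}}
    (hX : TopologicallyNoetherian X) : TopologicallyLocallyNoetherian X := fun _ =>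
  ⟨Set.univ, Filter.univ_mem, (noetherian_univ_iff).2 hX⟩

theorem TopologicallyLocallyNoetherian.topologicallyNoetherian {X : Scheme.{u}} [CompactSpace X]
    (hX : TopologicallyLocallyNoetherian X) : TopologicallyNoetherian X := by
  choose U hU hU' using hX
  obtain ⟨t, ht⟩ := CompactSpace.elim_nhds_subcover U hU
  have h : (⋃ x : t, U x) = Set.univ := by
    rw [← Set.top_eq_univ, ← ht]
    exact Set.iUnion_subtype _ _
  have h' := NoetherianSpace.iUnion (fun x : t => U x)
  rw [h] at h'
  exact noetherian_univ_iff.1 h'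

theorem noetherianSpace_primeSpectrum_iff {X : Scheme.{u}} {U : X.Opens} (hU : IsAffineOpen U) :
    NoetherianSpace (PrimeSpectrum Γ(X, U)) ↔ NoetherianSpace U :=
  noetherianSpace_iff_of_homeomorph hU.isoSpec.symm.hom.homeomorph

/-- The topological Hilbert basis theorem, applied on affine open subschemes. -/
theorem TopologicallyLocallyNoetherian.of_locallyOfFiniteType {X Y : Scheme.{u}} (f : X ⟶ Y)
    [LocallyOfFiniteType f] (hY : TopologicallyLocallyNoetherian Y) :
    TopologicallyLocallyNoetherian X := by
  intro x
  obtain ⟨U, hU, hU'⟩ := hY (f x)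
  obtain ⟨U', hU'U, hU'o, hxU'⟩ := mem_nhds_iff.1 hU
  obtain ⟨_, ⟨V, hV, rfl⟩, hxV, hVU⟩ :=
    Y.isBasis_affineOpens.exists_subset_of_mem_open hxU' hU'o
  obtain ⟨_, ⟨W, hW, rfl⟩, hxW, hWV⟩ :=
    X.isBasis_affineOpens.exists_subset_of_mem_open (show x ∈ f ⁻¹ᵁ V from hxV) (f ⁻¹ᵁ V).isOpen
  have h1 : NoetherianSpace V := NoetherianSpace.of_subset (hVU.trans hU'U)
  have h2 := (noetherianSpace_primeSpectrum_iff hV).2 h1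
  have h3 : (f.appLE V W hWV).hom.FiniteType := f.finiteType_appLE hV hW hWV
  algebraize [(f.appLE V W hWV).hom]
  have h4 := PrimeSpectrum.noetherianSpace_of_finiteType Γ(Y, V) Γ(X, W)
  exact ⟨W, W.isOpen.mem_nhds hxW, (noetherianSpace_primeSpectrum_iff hW).1 h4⟩

end Topology

/-! ### Noetherian stalks -/

section Stalks

theorem PointwiseNoetherian.of_surjectiveOnStalks {X Y : Scheme.{u}} (f : X ⟶ Y)
    [SurjectiveOnStalks f] (hY : PointwiseNoetherian Y) : PointwiseNoetherian X := fun x =>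
  have := hY (f x)
  isNoetherianRing_of_surjective _ _ (f.stalkMap x).hom (f.stalkMap_surjective x)

theorem PointwiseNoetherian.of_locallyOfFiniteType {X Y : Scheme.{u}} (f : X ⟶ Y)
    [LocallyOfFiniteType f] (hY : PointwiseNoetherian Y) : PointwiseNoetherian X := fun x => by
  have h1 := hY (f x)
  have h2 := LocallyOfFiniteType.stalkMap f x
  algebraize [(f.stalkMap x).hom]
  exact Algebra.EssFiniteType.isNoetherianRing (Y.presheaf.stalk (f x)) _

end Stalks

/-! ### The charts of `X_M(S)`, the projection to `S` and its sections -/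

section Cover

/-- The limit of a gluable diagram is covered by the members: it retracts onto the open subscheme
that they cover. -/
theorem exists_colimit_ι_eq {J : Type u} [Category.{u} J] (F : J ⥤ Scheme.{u}) [IsGluable F]
    (x : (colimit F : Scheme.{u})) : ∃ j y, colimit.ι F j y = x := by
  let U : (colimit F : Scheme.{u}).Opens := ⨆ j, (colimit.ι F j).opensRange
  have hU : ∀ j, Set.range (colimit.ι F j) ⊆ Set.range U.ι := fun j => by
    rw [Scheme.Opens.range_ι]
    exact le_iSup (fun j => (colimit.ι F j).opensRange) j
  let c : Cocone F :=
    { pt := U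
      ι :=
        { app := fun j => IsOpenImmersion.lift U.ι (colimit.ι F j) (hU j)
          naturality := fun i j f => by
            rw [← cancel_mono U.ι]
            simp } }
  have hc : colimit.desc F c ≫ U.ι = 𝟙 _ := colimit.hom_ext fun j => by
    simp [c]
  have hx : x ∈ U := by
    have h := congrArg (fun f => f x) hc
    rw [Scheme.Hom.comp_apply] at h
    have h' : U.ι (colimit.desc F c x) = x := h
    rw [← h']
    exact (colimit.desc F c x).2
  obtain ⟨j, y, hy⟩ := Opens.mem_iSup.1 hx
  exact ⟨j, y, hy⟩

variable {I : Type u} [SemilatticeInf I] (M : Iᵒᵖ ⥤ AddCommMonCat.{u}) [IsGluable (charts M)]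

/-- The covering of `X_M(ℤ)` by the affine schemes `Spec ℤ[M_i]`. -/
noncomputable def chartCover : (XInt M).OpenCover :=
  Scheme.Cover.mkOfCovers I (fun i => (charts M).obj i) (fun i => colimit.ι (charts M) i)
    (exists_colimit_ι_eq (charts M)) (fun i => isOpenImmersion_colimit_ι i)

/-- The covering of `X_M(S)` by the schemes `Spec ℤ[M_i] × S`. -/
noncomputable def prodCover (S : Scheme.{u}) : (X M S).OpenCover :=
  Scheme.Pullback.openCoverOfLeft (chartCover M) (terminal.from (XInt M)) (terminal.from S)

variable (S : Scheme.{u})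

/-- The projection `X_M(S) ⟶ S`. -/
noncomputable def proj : X M S ⟶ S := pullback.snd _ _

/-- The projection `Spec ℤ[M_i] × S ⟶ S`. -/
noncomputable def chartProj (i : I) : (prodCover M S).X i ⟶ S :=
  pullback.snd ((chartCover M).f i ≫ terminal.from (XInt M)) (terminal.from S)

theorem prodCover_f_proj (i : I) : (prodCover M S).f i ≫ proj M S = chartProj M S i := by
  exact (pullback.lift_snd _ _ _).trans (Category.comp_id _)

instance (i : I) : IsAffine ((chartCover M).X i) :=
  inferInstanceAs (IsAffine (Spec (monoidRing.obj (M.obj (op i)))))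

instance isAffineHom_chartProj (i : I) : IsAffineHom (chartProj M S i) := by
  unfold chartProj
  have : IsAffineHom ((chartCover M).f i ≫ terminal.from (XInt M)) := isAffineHom_of_isAffine _
  exact MorphismProperty.of_isPullback (P := @IsAffineHom) (IsPullback.of_hasPullback _ _) this

/-- The augmentation `ℤ[N] → R`, sending all elements of `N` to `1`. -/
noncomputable def augmentation (N : AddCommMonCat.{u}) (R : CommRingCat.{u}) :
    monoidRing.obj N ⟶ R :=
  CommRingCat.ofHom (AddMonoidAlgebra.lift ℤ R N 1).toRingHom

/-- The section of the projection `Spec ℤ[M_i] × S ⟶ S` given by the augmentation. -/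
noncomputable def chartSection (i : I) : S ⟶ (prodCover M S).X i :=
  pullback.lift (S.toSpecΓ ≫ Spec.map (augmentation (M.obj (op i)) Γ(S, ⊤))) (𝟙 S)
    (Subsingleton.elim _ _)

theorem chartSection_chartProj (i : I) : chartSection M S i ≫ chartProj M S i = 𝟙 S :=
  pullback.lift_snd _ _ _

instance isClosedImmersion_chartSection (i : I) : IsClosedImmersion (chartSection M S i) := by
  have : IsClosedImmersion (chartSection M S i ≫ chartProj M S i) := by
    rw [chartSection_chartProj]
    infer_instance
  exact IsClosedImmersion.of_comp _ (chartProj M S i)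

/-- The section of the projection `X_M(S) ⟶ S` given by the augmentation of `ℤ[M_i]`; all
properties of `X_M(S)` inherited by `S` are transported along it. -/
noncomputable def unitSection (i : I) : S ⟶ X M S := chartSection M S i ≫ (prodCover M S).f i

theorem unitSection_proj (i : I) : unitSection M S i ≫ proj M S = 𝟙 S := by
  rw [unitSection, Category.assoc, prodCover_f_proj, chartSection_chartProj]

instance isOpenImmersion_prodCover_f (i : I) : IsOpenImmersion ((prodCover M S).f i) :=
  (prodCover M S).map_prop i

instance isImmersion_unitSection (i : I) : IsImmersion (unitSection M S i) :=
  inferInstanceAs (IsImmersion (chartSection M S i ≫ (prodCover M S).f i))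

theorem proj_surjective [Nonempty I] : Function.Surjective (proj M S) := fun s => by
  let i : I := Classical.arbitrary I
  refine ⟨unitSection M S i s, ?_⟩
  rw [← Scheme.Hom.comp_apply, unitSection_proj]
  rfl

theorem quasiCompact_proj [Finite I] : QuasiCompact (proj M S) := by
  refine (quasiCompact_iff _).2 fun U hU hU' => ?_
  have h : proj M S ⁻¹' U = ⋃ i : I, (prodCover M S).f i '' (chartProj M S i ⁻¹' U) := by
    ext x
    simp only [Set.mem_preimage, Set.mem_iUnion, Set.mem_image]
    constructor
    · intro hx
      obtain ⟨i, y, rfl⟩ := (prodCover M S).exists_eq x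
      refine ⟨i, y, ?_, rfl⟩
      have h := congrArg (fun f => f y) (prodCover_f_proj M S i)
      exact h ▸ hx
    · rintro ⟨i, y, hy, rfl⟩
      have h := congrArg (fun f => f y) (prodCover_f_proj M S i)
      exact h ▸ hy
  rw [h]
  exact isCompact_iUnion fun i =>
    (QuasiCompact.isCompact_preimage U hU hU').image ((prodCover M S).f i).continuous

theorem isEmpty_X [IsEmpty I] : IsEmpty (X M S) := ⟨fun x => by
  obtain ⟨i, -⟩ := (prodCover M S).exists_eq x
  exact isEmptyElim (α := I) i⟩

/-! ### Finiteness of the projection and of the monoids -/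

theorem locallyOfFiniteType_terminal_from (A : CommRingCat.{u}) (hA : Algebra.FiniteType ℤ A) :
    LocallyOfFiniteType (terminal.from (Spec A)) := by
  let φ : CommRingCat.of (ULift.{u} ℤ) ⟶ A :=
    CommRingCat.ofHom ((algebraMap ℤ A).comp ULift.ringEquiv.toRingHom)
  have h1 : terminal.from (Spec A) = Spec.map φ ≫ terminal.from _ := Subsingleton.elim _ _
  have h2 : IsIso (terminal.from (Spec (CommRingCat.of (ULift.{u} ℤ)))) :=
    isIso_of_isTerminal specULiftZIsTerminal terminalIsTerminal _
  have h3 : LocallyOfFiniteType (Spec.map φ) := by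
    rw [HasRingHomProperty.Spec_iff (P := @LocallyOfFiniteType)]
    exact RingHom.FiniteType.comp (RingHom.finiteType_algebraMap.2 hA)
      (RingHom.FiniteType.of_surjective _ ULift.ringEquiv.surjective)
  rw [h1]
  infer_instance

theorem locallyOfFiniteType_proj (hM : FiniteType M) : LocallyOfFiniteType (proj M S) := by
  have h : LocallyOfFiniteType (terminal.from (XInt M)) := by
    have hX (i : (chartCover M).I₀) : IsAffine ((chartCover M).X i) :=
      inferInstanceAs (IsAffine (Spec (monoidRing.obj (M.obj (op i)))))
    rw [HasRingHomProperty.iff_of_source_openCover (P := @LocallyOfFiniteType) (chartCover M)]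
    intro i
    refine HasRingHomProperty.appTop (P := @LocallyOfFiniteType) _ ?_
    have h1 : (chartCover M).f i ≫ terminal.from (XInt M) =
        terminal.from (Spec (monoidRing.obj (M.obj (op i)))) := Subsingleton.elim _ _
    have := hM i
    exact h1 ▸ locallyOfFiniteType_terminal_from _
      (AddMonoidAlgebra.finiteType_of_fg (R := ℤ) (M := M.obj (op i)))
  exact MorphismProperty.of_isPullback (P := @LocallyOfFiniteType) (IsPullback.of_hasPullback _ _) h

/-- `R[N]` is a quotient of the ring of global sections of the affine scheme
`Spec ℤ[N] × Spec R`, the images of `ℤ[N]` and `R` generating it. -/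
theorem isNoetherianRing_addMonoidAlgebra (N : AddCommMonCat.{u}) (R : CommRingCat.{u})
    (f : Spec (monoidRing.obj N) ⟶ ⊤_ Scheme.{u}) (g : Spec R ⟶ ⊤_ Scheme.{u})
    [IsLocallyNoetherian (pullback f g)] : IsNoetherianRing (AddMonoidAlgebra R N) := by
  let B : CommRingCat.{u} := CommRingCat.of (AddMonoidAlgebra R N)
  let a : monoidRing.obj N ⟶ B :=
    CommRingCat.ofHom (AddMonoidAlgebra.mapRingHom N (Int.castRingHom R))
  let b : R ⟶ B := CommRingCat.ofHom (algebraMap R (AddMonoidAlgebra R N))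
  let W := pullback f g
  let h : Spec B ⟶ W := pullback.lift (Spec.map a) (Spec.map b) (Subsingleton.elim _ _)
  obtain ⟨ψ, hψ⟩ := Spec.map_surjective (h ≫ W.isoSpec.hom)
  obtain ⟨α, hα⟩ := Spec.map_surjective (W.isoSpec.inv ≫ pullback.fst f g)
  obtain ⟨β, hβ⟩ := Spec.map_surjective (W.isoSpec.inv ≫ pullback.snd f g)
  have ha : α ≫ ψ = a := Spec.map_injective <| by
    rw [Spec.map_comp, hψ, hα]
    simpa using pullback.lift_fst _ _ _
  have hb : β ≫ ψ = b := Spec.map_injective <| by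
    rw [Spec.map_comp, hψ, hβ]
    simpa using pullback.lift_snd _ _ _
  have hrange : ∀ x : AddMonoidAlgebra R N, x ∈ ψ.hom.range := fun x => by
    induction x using AddMonoidAlgebra.induction_on with
    | of n =>
      refine ⟨α (AddMonoidAlgebra.single n 1), ?_⟩
      change (α ≫ ψ) _ = _
      rw [ha]
      change AddMonoidAlgebra.mapRingHom _ _ (AddMonoidAlgebra.single _ _) = _
      simp
    | add x y hx hy => exact add_mem hx hy
    | smul r x hx =>
      have hr : algebraMap R (AddMonoidAlgebra R N) r ∈ ψ.hom.range := by
        refine ⟨β r, ?_⟩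
        change (β ≫ ψ) _ = _
        rw [hb]
        rfl
      rw [Algebra.smul_def]
      exact mul_mem hr hx
  have hnoeth : IsNoetherianRing Γ(W, ⊤) :=
    IsLocallyNoetherian.component_noetherian ⟨⊤, isAffineOpen_top W⟩
  exact isNoetherianRing_of_surjective _ _ ψ.hom hrange

theorem finiteType_of_isLocallyNoetherian [IsLocallyNoetherian (X M S)] [Nonempty S] :
    FiniteType M := by
  intro i
  obtain ⟨j, x, -⟩ := S.affineCover.exists_eq (Classical.arbitrary S)
  -- the monoid ring is formed over a nontrivial ring `R` with `Spec R` open in `S`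
  obtain ⟨R, hR⟩ : ∃ R : CommRingCat.{u}, S.affineCover.X j = Spec R := ⟨_, rfl⟩
  let k : Spec R ⟶ S := eqToHom hR.symm ≫ S.affineCover.f j
  have hk : IsOpenImmersion k := inferInstance
  have hne : Nonempty (Spec R) := ⟨eqToHom hR x⟩
  have hR' : Nontrivial R := PrimeSpectrum.nonempty_iff_nontrivial.1 hne
  -- `Spec ℤ[M_i] × Spec R` is an open subscheme of `X_M(S)`
  let p : Spec (monoidRing.obj (M.obj (op i))) ⟶ XInt M := colimit.ι (charts M) i
  have hp : IsOpenImmersion p := isOpenImmersion_colimit_ι i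
  let f := terminal.from (Spec (monoidRing.obj (M.obj (op i))))
  let g := terminal.from (Spec R)
  let q : pullback f g ⟶ X M S :=
    pullback.map f g (terminal.from (XInt M)) (terminal.from S) p k (𝟙 _)
      (Subsingleton.elim _ _) (Subsingleton.elim _ _)
  have hq : IsOpenImmersion q := inferInstanceAs (IsOpenImmersion (pullback.map _ _ _ _ _ _ _ _ _))
  have := isLocallyNoetherian_of_isOpenImmersion q
  have := isNoetherianRing_addMonoidAlgebra (M.obj (op i)) R f g
  exact AddCon.fg_of_isNoetherianRing_addMonoidAlgebra R (M.obj (op i))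

theorem isLocallyNoetherian_X_iff :
    IsLocallyNoetherian (X M S) ↔
      (IsLocallyNoetherian S ∧ (FiniteType M ∨ IsEmpty S)) ∨ IsEmpty I := by
  constructor
  · intro h
    by_cases hI : IsEmpty I
    · exact Or.inr hI
    obtain ⟨i⟩ := not_isEmpty_iff.1 hI
    refine Or.inl ⟨LocallyOfFiniteType.isLocallyNoetherian (unitSection M S i), ?_⟩
    by_cases hS : IsEmpty S
    · exact Or.inr hS
    · have := not_isEmpty_iff.1 hS
      exact Or.inl (finiteType_of_isLocallyNoetherian M S)
  · rintro (⟨hS, hM | hE⟩ | hI)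
    · have := locallyOfFiniteType_proj M S hM
      exact LocallyOfFiniteType.isLocallyNoetherian (proj M S)
    · have : IsEmpty (X M S) := Function.isEmpty (proj M S)
      exact isLocallyNoetherian_of_isOpenImmersion (proj M S)
    · have := isEmpty_X M S
      have : IsNoetherianRing (ULift.{u} ℤ) :=
        isNoetherianRing_of_ringEquiv ℤ ULift.ringEquiv.symm
      exact isLocallyNoetherian_of_isOpenImmersion (specULiftZIsTerminal.from (X M S))

end Cover

end MonoidGluing

open AlgebraicGeometry CategoryTheory TopologicalSpace MonoidGluing

theorem propositionn70 {I : Type u} [SemilatticeInf I]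
    (M : CategoryTheory.Functor Iᵒᵖ AddCommMonCat.{u})
    (hM : MonoidGluing.OpenlyImmersive M)
    [MonoidGluing.IsGluable (MonoidGluing.charts M)]
    (S : AlgebraicGeometry.Scheme.{u}) :
    -- a) locally noetherian
    (AlgebraicGeometry.IsLocallyNoetherian (MonoidGluing.X M S) ↔
      (AlgebraicGeometry.IsLocallyNoetherian S ∧ (MonoidGluing.FiniteType M ∨ IsEmpty S)) ∨
        IsEmpty I) ∧
    -- b) noetherian
    ((AlgebraicGeometry.IsNoetherian (MonoidGluing.X M S) →
        (AlgebraicGeometry.IsNoetherian S ∧ (MonoidGluing.FiniteType M ∨ IsEmpty S)) ∨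
          IsEmpty I) ∧
      (Finite I →
        (AlgebraicGeometry.IsNoetherian S ∧ (MonoidGluing.FiniteType M ∨ IsEmpty S)) ∨
          IsEmpty I →
        AlgebraicGeometry.IsNoetherian (MonoidGluing.X M S))) ∧
    -- c) pointwise noetherian
    ((MonoidGluing.PointwiseNoetherian (MonoidGluing.X M S) →
        MonoidGluing.PointwiseNoetherian S ∨ IsEmpty I) ∧
      (MonoidGluing.FiniteType M →
        MonoidGluing.PointwiseNoetherian S ∨ IsEmpty I →
        MonoidGluing.PointwiseNoetherian (MonoidGluing.X M S))) ∧
    -- d) topologically locally noetherian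
    ((Finite I →
        MonoidGluing.TopologicallyLocallyNoetherian (MonoidGluing.X M S) →
        MonoidGluing.TopologicallyLocallyNoetherian S ∨ IsEmpty I) ∧
      (MonoidGluing.FiniteType M →
        MonoidGluing.TopologicallyLocallyNoetherian S ∨ IsEmpty I →
        MonoidGluing.TopologicallyLocallyNoetherian (MonoidGluing.X M S))) ∧
    -- e) topologically noetherian
    ((MonoidGluing.TopologicallyNoetherian (MonoidGluing.X M S) →
        MonoidGluing.TopologicallyNoetherian S ∨ IsEmpty I) ∧
      (Finite I → MonoidGluing.FiniteType M →
        MonoidGluing.TopologicallyNoetherian S ∨ IsEmpty I →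
        MonoidGluing.TopologicallyNoetherian (MonoidGluing.X M S))) ∧
    -- f) jacobsonian
    ((MonoidGluing.Jacobsonian (MonoidGluing.X M S) →
        MonoidGluing.Jacobsonian S ∨ IsEmpty I) ∧
      (MonoidGluing.FiniteType M →
        MonoidGluing.Jacobsonian S ∨ IsEmpty I →
        MonoidGluing.Jacobsonian (MonoidGluing.X M S))) := by
  have hfin := locallyOfFiniteType_proj M S
  have ha := isLocallyNoetherian_X_iff M S
  have hsec : ∀ p q : Prop, (∀ _ : I, p → q) → p → q ∨ IsEmpty I := fun p q h hp => by
    by_cases hI : IsEmpty I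
    · exact Or.inr hI
    · obtain ⟨i⟩ := not_isEmpty_iff.1 hI
      exact Or.inl (h i hp)
  have hconv : ∀ p q : Prop, (p → q) → (IsEmpty (X M S) → q) → p ∨ IsEmpty I → q :=
    fun p q h h' hp => hp.elim h fun _ => h' (isEmpty_X M S)
  refine ⟨ha, ⟨fun h => ?_, fun _ h => ?_⟩, ⟨hsec _ _ fun i h => ?_, fun hf => hconv _ _ ?_ ?_⟩,
    ⟨fun _ => hsec _ _ fun i h => ?_, fun hf => hconv _ _ ?_ ?_⟩,
    ⟨hsec _ _ fun i h => ?_, fun _ hf => hconv _ _ ?_ ?_⟩,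
    ⟨hsec _ _ fun i h => ?_, fun hf => hconv _ _ ?_ ?_⟩⟩
  · refine (ha.1 inferInstance).elim (fun h' => ?_) Or.inr
    by_cases hI : IsEmpty I
    · exact Or.inr hI
    have := not_isEmpty_iff.1 hI
    have hc : CompactSpace S := (proj_surjective M S).compactSpace (proj M S).continuous
    have := h'.1
    exact Or.inl ⟨⟨⟩, h'.2⟩
  · have hln := ha.2 (h.imp_left fun h' => ⟨h'.1.toIsLocallyNoetherian, h'.2⟩)
    have hc : CompactSpace (X M S) := by
      rcases h with h' | hI
      · have := h'.1
        have := quasiCompact_proj M S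
        exact QuasiCompact.compactSpace_of_compactSpace (proj M S)
      · have := isEmpty_X M S
        infer_instance
    exact ⟨⟩
  · exact h.of_surjectiveOnStalks (unitSection M S i)
  · intro h
    have := hfin hf
    exact h.of_locallyOfFiniteType (proj M S)
  · exact fun h x => h.elim x
  · exact h.of_isInducing _ (unitSection M S i).isEmbedding.isInducing
  · intro h
    have := hfin hf
    exact h.of_locallyOfFiniteType (proj M S)
  · exact fun h x => h.elim x
  · have : NoetherianSpace (X M S) := h
    exact (unitSection M S i).isEmbedding.isInducing.noetherianSpace
  · intro h
    have := hfin hf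
    have : NoetherianSpace S := h
    have := quasiCompact_proj M S
    have := QuasiCompact.compactSpace_of_compactSpace (proj M S)
    exact (h.topologicallyLocallyNoetherian.of_locallyOfFiniteType
      (proj M S)).topologicallyNoetherian
  · exact fun _ => inferInstanceAs (NoetherianSpace (X M S))
  · have : JacobsonSpace (X M S) := h
    have : JacobsonSpace ((prodCover M S).X i) :=
      .of_isOpenEmbedding ((prodCover M S).f i).isOpenEmbedding
    exact .of_isClosedEmbedding (chartSection M S i).isClosedEmbedding
  · intro h
    have : JacobsonSpace S := h
    have := hfin hf
    exact LocallyOfFiniteType.jacobsonSpace (proj M S)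
  · exact fun _ => inferInstanceAs (JacobsonSpace (X M S))
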